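/- Let $d,r,T\ge 1$ be integers, let $p\in[1,2)$ with Hölder conjugate $q$ ($\tfrac1p+\tfrac1q=1$, $q=\infty$ if $p=1$), and let $D,B>0$. **Domains.** Let $\mathbb X_p(D)$ be the collection of nonempty convex compact sets $\mathcal X\subseteq\mathbb R^d$ with $\|x-y\|_p\le D$ for all $x,y\in\mathcal X$. **Functions and oracles.** For $s\in[1,\infty]$ with Hölder conjugate $s'$, let $\mathcal O_{c,s}$ be the set of all pairs $(f,O)$ where $f$ is a real-valued convex function on $\mathcal X$ and $O$ is a stochastic first-order oracle: a query $x\in\mathcal X$ is answered by a random vector $\hat g(x)\in\mathbb R^d$ whose law is given by a Markov kernel in $x$ (given the query point, the answer is independent of the past), with $\mathbb E[\hat g(x)]\in\partial f(x)=\{g:\ f(y)\ge f(x)+\langle g,y-x\rangle\ \forall y\in\mathcal X\}$ and $\|\hat g(x)\|_{s'}\le B$ almost surely. **Protocols.** Let $\mathcal W_{\mathrm{com},r}$ be the set of all $r$-bit channels, i.e. Markov kernels from $\mathbb R^d$ to $\{0,1\}^r$. In round $t=1,\dots,T$ the algorithm $\pi$ queries a point $x_t\in\mathcal X$ that depends on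 the previous messages $Y_1,\dots,Y_{t-1}$ and on private randomness; an adaptive channel selection strategy $S$ picks a channel $W_t\in\mathcal W_{\mathrm{com},r}$ as a function of $Y_1,\dots,Y_{t-1}$; and the algorithm receives $Y_t\sim W_t(\cdot\mid \hat g(x_t))$. After $T$ rounds the algorithm outputs a point $\hat x\in\mathcal X$ depending on $Y_1,\dots,Y_T$ and its private randomness. The adaptive minmax optimization error is $$\mathcal E^*(\mathcal X,\mathcal O,T,\mathcal W_{\mathrm{com},r})=\inf_{\pi}\ \inf_{S}\ \sup_{(f,O)\in\mathcal O}\ \mathbb E\Big[f(\hat x)-\min_{x\in\mathcal X}f(x)\Big].$$ **Theorem.** If $T\ge \frac{d}{6r}$, then, with $c_0=\frac{1}{12\sqrt{58}}$, $$\sup_{\mathcal X\in\mathbb X_p(D)}\mathcal E^*(\mathcal X,\mathcal O_{c,p},T,\mathcal W_{\mathrm{com},r})\ \ge\ \frac{c_0DB}{\sqrt T}\sqrt{\frac{d}{\min\{d,r\}}},$$ and the same lower bound holds for $\sup_{\mathcal X\in\mathbb X_p(D)}\mathcal E^*(\mathcal X,\mathcal O_{c,1},T,\mathcal W_{\mathrm{com},r})$.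 -/

import Mathlib

open MeasureTheory ProbabilityTheory
open scoped ENNReal

namespace CommOpt

noncomputable section

/-- The `ℓ_p` norm on `ℝ^d`, for `p ∈ [1, ∞]`. -/
def ellNorm {d : ℕ} (p : ℝ≥0∞) (x : Fin d → ℝ) : ℝ := ‖WithLp.toLp p x‖

/-- The admissible domains: the (nonempty, convex, compact) subsets of `ℝ^d` whose `ℓ_p` diameter
is at most `D`. -/
def domains (d : ℕ) (p : ℝ≥0∞) (D : ℝ) : Set (Set (Fin d → ℝ)) :=
  {X | X.Nonempty ∧ Convex ℝ X ∧ IsCompact X ∧ ∀ x ∈ X, ∀ y ∈ X, ellNorm p (x - y) ≤ D}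

/-- The set `∂f(x)` of subgradients at `x` of a function `f` on the domain `X`. -/
def subgradients {d : ℕ} (X : Set (Fin d → ℝ)) (f : (Fin d → ℝ) → ℝ) (x : Fin d → ℝ) :
    Set (Fin d → ℝ) :=
  {g | ∀ y ∈ X, f x + g ⬝ᵥ (y - x) ≤ f y}

/-- The class `𝒪_{c,p}`: pairs of a convex function on `X` and a stochastic first-order oracle.
The oracle answers a query at `x` with a random vector of law `O x`, which has norm at most `B`
almost surely in the conjugate exponent `q = p / (p - 1)` (with `q = ∞` for `p = 1`) and whose mean
is a subgradient at `x`. -/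
def convexOracles {d : ℕ} (X : Set (Fin d → ℝ)) (p : ℝ≥0∞) (B : ℝ) :
    Set (((Fin d → ℝ) → ℝ) × Kernel X (Fin d → ℝ)) :=
  {fO | ConvexOn ℝ X fO.1 ∧ IsMarkovKernel fO.2 ∧ ∀ x : X,
    (∀ᵐ g ∂(fO.2 x), ellNorm (ENNReal.conjExponent p) g ^ 2 ≤ B ^ 2) ∧
    (∫ g, g ∂(fO.2 x)) ∈ subgradients X fO.1 x}

/-- The `r`-bit communication-constrained channels from `ℝ^d` to `{0,1}^r`. -/
def commChannels (d r : ℕ) : Set (Kernel (Fin d → ℝ) (Fin r → Bool)) :=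
  {W | IsMarkovKernel W}

/-- The first `t` entries of a sequence of length `T`. -/
def past {Y : Type} {T : ℕ} (y : Fin T → Y) (t : Fin T) : Fin t → Y :=
  fun s => y (Fin.castLE t.isLt.le s)

/-- A (possibly randomized) first-order optimization algorithm on `X` with `T` queries: the query
points depend on the messages received so far and on private randomness, and the final point on
all `T` messages and the same randomness. -/
structure Algorithm {d : ℕ} (X : Set (Fin d → ℝ)) (Y : Type) (T : ℕ) where
  Seed : Type
  [measurableSpace : MeasurableSpace Seed]
  law : Measure Seed
  [isProbabilityMeasure : IsProbabilityMeasure law]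
  query : (t : Fin T) → Seed → (Fin t → Y) → X
  output : Seed → (Fin T → Y) → X
  measurable_query : ∀ t h, Measurable fun u => query t u h
  measurable_output : ∀ h, Measurable fun u => output u h

attribute [instance] Algorithm.measurableSpace Algorithm.isProbabilityMeasure

/-- An adaptive channel selection strategy over `T` rounds: the channel of a round is chosen from
the family `𝒲` as a function of the messages received before. -/
abbrev Strategy {d : ℕ} {Y : Type} [MeasurableSpace Y] (𝒲 : Set (Kernel (Fin d → ℝ) Y)) (T : ℕ) :=
  (t : Fin T) → (Fin t → Y) → 𝒲

section Protocol

variable {d T : ℕ} {X : Set (Fin d → ℝ)} {Y : Type} [MeasurableSpace Y]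
  {𝒲 : Set (Kernel (Fin d → ℝ) Y)}

/-- The conditional law of the message of round `t`, given the private randomness `u` and the
previous messages `h`: the oracle's answer at the query point is passed through the channel. -/
def messageLaw (O : Kernel X (Fin d → ℝ)) (π : Algorithm X Y T) (S : Strategy 𝒲 T) (t : Fin T)
    (u : π.Seed) (h : Fin t → Y) : Measure Y :=
  (O (π.query t u h)).bind (S t h).1

/-- The probability, given the private randomness `u`, that the messages are `y 0, y 1, …`. -/
def transcriptProb (O : Kernel X (Fin d → ℝ)) (π : Algorithm X Y T) (S : Strategy 𝒲 T)
    (u : π.Seed) (y : Fin T → Y) : ℝ≥0∞ :=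
  ∏ t : Fin T, messageLaw O π S t u (past y t) {y t}

/-- The expected optimization error `E[f(x̂) - min_X f]` of the final point `x̂`, for a finite
message alphabet. -/
def optError [Fintype Y] (f : (Fin d → ℝ) → ℝ) (O : Kernel X (Fin d → ℝ)) (π : Algorithm X Y T)
    (S : Strategy 𝒲 T) : ℝ≥0∞ :=
  ∫⁻ u, ∑ y : Fin T → Y,
    transcriptProb O π S u y * ENNReal.ofReal (f (π.output u y) - sInf (f '' X)) ∂π.law

end Protocol

/-- The adaptive minmax optimization error `ℰ*(X, 𝒪, T, 𝒲)`. -/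
def minmaxError {d : ℕ} {Y : Type} [MeasurableSpace Y] [Fintype Y] (X : Set (Fin d → ℝ))
    (𝒪 : Set (((Fin d → ℝ) → ℝ) × Kernel X (Fin d → ℝ))) (T : ℕ)
    (𝒲 : Set (Kernel (Fin d → ℝ) Y)) : ℝ≥0∞ :=
  ⨅ π : Algorithm X Y T, ⨅ S : Strategy 𝒲 T, ⨆ fO ∈ 𝒪, optError fO.1 fO.2 π S

end

end CommOpt

namespace CommOpt

/-! The bound reduces optimization to estimating a hidden sign vector `v` in `{±1}^d`. On the cube
`[-b, b]^d` take the linear objective with gradient `-βμ • v`, and an oracle that ignores the query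
point and returns `-β • z`, where `z` has independent signs with mean `μ • v`. The error of an
output `x` is at least `βμb ∑ (1 - v i * x i / b)`, so a small error forces `x` to agree with most
coordinates of `v` (`le_objective_sub_sInf`).

Each message has only `r` bits. The chi-square distances between its laws under `v` and under `v`
with coordinate `i` flipped, summed over `i`, are of order `μ² min(d, r)`. For `r ≤ d` this follows
from sub-Gaussianity of `z` and Jensen's inequality (`sum_sum_outCorr_sq_div_le_bits`); for `d ≤ r`
each coordinate contributes at most a constant.

Squared Hellinger distance carries this to adaptive transcripts: it is bounded by the expected sum
of the one-step distances under the average of the two laws (`hellingerSq_pathMass_le`). Summing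
over all `v` and using symmetry under flips replaces that average by the law of `v`, so the sum over
`i` can be taken inside one expectation. Assouad's argument (`le_sum_pathMass_mul`) then gives error
of order `βμbd` when `T min(d, r) μ²` is at most a small multiple of `d`. The scales `b ~ D
d^(-1/p)`, `β ~ B d^(-1/q)`, `μ ~ √(d / (T min(d, r)))` give the rate. -/

/-! ### Signs, coordinate flips and product laws on the hypercube. -/

/-- The sign `±1` encoded by a Boolean. -/
def sgn (b : Bool) : ℝ := if b then 1 else -1

theorem sgn_not (b : Bool) : sgn (!b) = -sgn b := by cases b <;> simp [sgn]

theorem sgn_mul_self (b : Bool) : sgn b * sgn b = 1 := by cases b <;> simp [sgn]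

theorem abs_sgn (b : Bool) : |sgn b| = 1 := by cases b <;> simp [sgn]

theorem sgn_mul_sgn_cases (a b : Bool) : sgn a * sgn b = 1 ∨ sgn a * sgn b = -1 := by
  cases a <;> cases b <;> simp [sgn]

/-- Flip the `i`-th coordinate of a point of the hypercube. -/
def flipAt {d : ℕ} (i : Fin d) (v : Fin d → Bool) : Fin d → Bool := Function.update v i (!v i)

theorem flipAt_involutive {d : ℕ} (i : Fin d) : Function.Involutive (flipAt i) := by
  intro v
  simp [flipAt]

theorem sgn_flipAt_self {d : ℕ} (i : Fin d) (v : Fin d → Bool) :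
    sgn (flipAt i v i) = -sgn (v i) := by
  simp [flipAt, sgn_not]

theorem sum_flipAt {d : ℕ} (i : Fin d) (F : (Fin d → Bool) → ℝ) :
    ∑ v, F (flipAt i v) = ∑ v, F v :=
  Equiv.sum_comp (flipAt_involutive i).toPerm F

/-- The mass at `z` of the product law on `{±1}^d` with mean vector `μ • v`. -/
noncomputable def prodMass {d : ℕ} (μ : ℝ) (v z : Fin d → Bool) : ℝ :=
  ∏ i, ((1 + μ * (sgn (v i) * sgn (z i))) / 2)

/-- Independence of the coordinates: the expectation of a product factorizes. Mass, mean and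
exponential moments all follow from it. -/
theorem sum_prodMass_mul_prod {d : ℕ} (μ : ℝ) (v : Fin d → Bool) (g : Fin d → Bool → ℝ) :
    ∑ z, prodMass μ v z * ∏ i, g i (z i)
      = ∏ i, ∑ b, (1 + μ * (sgn (v i) * sgn b)) / 2 * g i b := by
  rw [Finset.prod_univ_sum, Fintype.piFinset_univ]
  simp only [prodMass, Finset.prod_mul_distrib]

theorem sum_prodMass {d : ℕ} (μ : ℝ) (v : Fin d → Bool) : ∑ z, prodMass μ v z = 1 := by
  have h := sum_prodMass_mul_prod μ v fun _ _ => 1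
  simp only [Finset.prod_const_one, mul_one] at h
  rw [h]
  refine Finset.prod_eq_one fun i _ => ?_
  simp [sgn]
  ring

theorem sum_prodMass_mul_sgn {d : ℕ} (μ : ℝ) (v : Fin d → Bool) (i : Fin d) :
    ∑ z, prodMass μ v z * sgn (z i) = μ * sgn (v i) := by
  have h := sum_prodMass_mul_prod μ v fun j b => if j = i then sgn b else 1
  simp only [Finset.prod_ite_eq', Finset.mem_univ, if_true] at h
  rw [h, Finset.prod_eq_single i]
  · simp [sgn]
    ring
  · intro j _ hj
    simp [hj, sgn]
    ring
  · simp

/-! ### Information about `v` in a single message. -/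

section Bias

variable {d : ℕ} {μ : ℝ}

theorem prodMass_pos (h0 : 0 ≤ μ) (h1 : μ < 1) (v z : Fin d → Bool) : 0 < prodMass μ v z := by
  refine Finset.prod_pos fun i _ => ?_
  rcases sgn_mul_sgn_cases (v i) (z i) with h | h <;> rw [h] <;> linarith

theorem prodMass_flipAt_mul (v z : Fin d → Bool) (i : Fin d) :
    prodMass μ (flipAt i v) z * (1 + μ * (sgn (v i) * sgn (z i)))
      = prodMass μ v z * (1 - μ * (sgn (v i) * sgn (z i))) := by
  unfold prodMass
  rw [← Finset.mul_prod_erase _ _ (Finset.mem_univ i),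
    ← Finset.mul_prod_erase Finset.univ (fun j => (1 + μ * (sgn (v j) * sgn (z j))) / 2)
      (Finset.mem_univ i)]
  have : ∏ j ∈ Finset.univ.erase i, (1 + μ * (sgn (flipAt i v j) * sgn (z j))) / 2
      = ∏ j ∈ Finset.univ.erase i, (1 + μ * (sgn (v j) * sgn (z j))) / 2 := by
    refine Finset.prod_congr rfl fun j hj => ?_
    rw [flipAt, Function.update_of_ne (Finset.ne_of_mem_erase hj)]
  rw [this, sgn_flipAt_self]
  ring

/-- The score identity: the difference of the masses for neighbouring parameters. -/
theorem prodMass_sub_flipAt (h0 : 0 ≤ μ) (h1 : μ < 1) (v z : Fin d → Bool) (i : Fin d) :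
    prodMass μ v z - prodMass μ (flipAt i v) z
      = 2 * μ / (1 - μ ^ 2) * sgn (v i) * (prodMass μ v z * (sgn (z i) - μ * sgn (v i))) := by
  have h := prodMass_flipAt_mul (μ := μ) v z i
  have hv := sgn_mul_self (v i)
  have hμ : (1 : ℝ) - μ ^ 2 ≠ 0 := by nlinarith
  set ρ := sgn (v i) * sgn (z i) with hρ
  have e : sgn (v i) * (prodMass μ v z * (sgn (z i) - μ * sgn (v i)))
      = prodMass μ v z * (ρ - μ) := by
    rw [hρ]
    linear_combination (-prodMass μ v z * μ) * hv
  rw [mul_assoc, e]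
  field_simp
  rcases sgn_mul_sgn_cases (v i) (z i) with h' | h' <;> rw [← hρ] at h' <;> rw [h'] at h ⊢
  · linear_combination (1 - μ) * -h
  · linear_combination (1 + μ) * -h

/-- Symmetrization: by Jensen, the factor `exp (-c * mean)` is at most the expectation of `exp (-c *
X')` for a copy `X'`. The resulting product is at most `cosh c ^ 2` by AM-GM. Hoeffding's sharper `c
^ 2 / 2` is not needed. -/
theorem two_point_exp_le (h0 : 0 ≤ μ) (h1 : μ < 1) (c : ℝ) (a : Bool) :
    ∑ b, (1 + μ * (sgn a * sgn b)) / 2 * Real.exp (c * (sgn b - μ * sgn a)) ≤ Real.exp (c ^ 2) := by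
  have key : ∀ m : ℝ, -1 < m → m < 1 →
      (1 + m) / 2 * Real.exp (c * (1 - m)) + (1 - m) / 2 * Real.exp (c * (-1 - m))
        ≤ Real.exp (c ^ 2) := by
    intro m hm1 hm2
    have e1 : Real.exp (c * (1 - m)) = Real.exp c * Real.exp (-(c * m)) := by
      rw [← Real.exp_add]; ring_nf
    have e2 : Real.exp (c * (-1 - m)) = Real.exp (-c) * Real.exp (-(c * m)) := by
      rw [← Real.exp_add]; ring_nf
    have jensen : Real.exp (-(c * m)) ≤ (1 + m) / 2 * Real.exp (-c) + (1 - m) / 2 * Real.exp c := by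
      have := convexOn_exp.2 (Set.mem_univ (-c)) (Set.mem_univ c)
        (show 0 ≤ (1 + m) / 2 by linarith) (show 0 ≤ (1 - m) / 2 by linarith) (by ring)
      simp only [smul_eq_mul] at this
      rwa [show (1 + m) / 2 * -c + (1 - m) / 2 * c = -(c * m) by ring] at this
    have hcosh : Real.cosh c ^ 2 ≤ Real.exp (c ^ 2) := by
      have h := Real.cosh_le_exp_half_sq c
      have : Real.exp (c ^ 2) = Real.exp (c ^ 2 / 2) ^ 2 := by
        rw [← Real.exp_nat_mul]; congr 1; push_cast; ring
      rw [this]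
      exact pow_le_pow_left₀ (Real.cosh_pos c).le h 2
    rw [Real.cosh_eq] at hcosh
    rw [e1, e2]
    set x := Real.exp c
    set y := Real.exp (-c)
    have hx : 0 < x := Real.exp_pos c
    have hy : 0 < y := Real.exp_pos (-c)
    have hpos : 0 ≤ (1 + m) / 2 * x + (1 - m) / 2 * y := by
      have : 0 ≤ (1 + m) / 2 := by linarith
      have : 0 ≤ (1 - m) / 2 := by linarith
      positivity
    have := mul_le_mul_of_nonneg_left jensen hpos
    nlinarith [sq_nonneg (m * (x - y))]
  rcases a with _ | _
  · have := key (-μ) (by linarith) (by linarith)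
    simp only [Fintype.sum_bool, sgn]
    norm_num
    convert this using 1
    ring_nf
  · have := key μ (by linarith) (by linarith)
    simp only [Fintype.sum_bool, sgn]
    norm_num
    rwa [← sub_eq_add_neg]

theorem sum_prodMass_mul_exp_le (h0 : 0 ≤ μ) (h1 : μ < 1) (v : Fin d → Bool) (c : Fin d → ℝ) :
    ∑ z, prodMass μ v z * Real.exp (∑ i, c i * (sgn (z i) - μ * sgn (v i)))
      ≤ Real.exp (∑ i, c i ^ 2) := by
  simp_rw [Real.exp_sum]
  rw [sum_prodMass_mul_prod μ v fun i b => Real.exp (c i * (sgn b - μ * sgn (v i)))]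
  refine Finset.prod_le_prod (fun i _ => Finset.sum_nonneg fun b _ => ?_)
    fun i _ => two_point_exp_le h0 h1 (c i) (v i)
  refine mul_nonneg ?_ (Real.exp_pos _).le
  rcases sgn_mul_sgn_cases (v i) b with h | h <;> rw [h] <;> linarith

variable {Y : Type}

/-- The probability of the message `y` when the input of the channel `W` has law `prodMass μ v`. -/
noncomputable def outMass (μ : ℝ) (W : (Fin d → Bool) → Y → ℝ) (v : Fin d → Bool) (y : Y) : ℝ :=
  ∑ z, prodMass μ v z * W z y

/-- The correlation of the centred `i`-th input coordinate with the event of message `y`. -/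
noncomputable def outCorr (μ : ℝ) (W : (Fin d → Bool) → Y → ℝ) (v : Fin d → Bool) (i : Fin d) (y : Y) : ℝ :=
  ∑ z, prodMass μ v z * (sgn (z i) - μ * sgn (v i)) * W z y

theorem outMass_nonneg (h0 : 0 ≤ μ) (h1 : μ < 1) {W : (Fin d → Bool) → Y → ℝ}
    (hW : ∀ z y, 0 ≤ W z y) (v : Fin d → Bool) (y : Y) : 0 ≤ outMass μ W v y :=
  Finset.sum_nonneg fun z _ => mul_nonneg (prodMass_pos h0 h1 v z).le (hW z y)

theorem outMass_sub_flipAt (h0 : 0 ≤ μ) (h1 : μ < 1) (W : (Fin d → Bool) → Y → ℝ)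
    (v : Fin d → Bool) (i : Fin d) (y : Y) :
    outMass μ W v y - outMass μ W (flipAt i v) y
      = 2 * μ / (1 - μ ^ 2) * sgn (v i) * outCorr μ W v i y := by
  unfold outMass outCorr
  rw [← Finset.sum_sub_distrib, Finset.mul_sum]
  refine Finset.sum_congr rfl fun z _ => ?_
  rw [← sub_mul, prodMass_sub_flipAt h0 h1]
  ring

variable [Fintype Y]

theorem sum_outMass {W : (Fin d → Bool) → Y → ℝ} (hW1 : ∀ z, ∑ y, W z y = 1)
    (v : Fin d → Bool) : ∑ y, outMass μ W v y = 1 := by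
  unfold outMass
  rw [Finset.sum_comm]
  simp_rw [← Finset.mul_sum, hW1, mul_one]
  exact sum_prodMass μ v

/-- The correlations with a single coordinate, by Cauchy–Schwarz. -/
theorem sum_outCorr_sq_div_le (h0 : 0 ≤ μ) (h1 : μ ≤ 1 / 2) {W : (Fin d → Bool) → Y → ℝ}
    (hW : ∀ z y, 0 ≤ W z y) (hW1 : ∀ z, ∑ y, W z y = 1) (v : Fin d → Bool) (i : Fin d) :
    ∑ y, outCorr μ W v i y ^ 2 / outMass μ W v y ≤ 3 := by
  have hlt : μ < 1 := by linarith
  have hle : ∀ y, outCorr μ W v i y ^ 2 / outMass μ W v y ≤ 3 * outMass μ W v y := by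
    intro y
    have hq := outMass_nonneg h0 hlt hW v y
    refine div_le_of_le_mul₀ hq (by positivity) ?_
    -- A centred coordinate is at most `1 + μ ≤ 3 / 2` in absolute value, and `(3 / 2) ^ 2 ≤ 3`.
    have habs : |outCorr μ W v i y| ≤ 3 / 2 * outMass μ W v y := by
      unfold outCorr outMass
      rw [Finset.mul_sum]
      refine (Finset.abs_sum_le_sum_abs _ _).trans (Finset.sum_le_sum fun z _ => ?_)
      have hp := (prodMass_pos h0 hlt v z).le
      rw [abs_mul, abs_mul, abs_of_nonneg hp, abs_of_nonneg (hW z y)]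
      have : |sgn (z i) - μ * sgn (v i)| ≤ 3 / 2 := by
        refine (abs_sub _ _).trans ?_
        rw [abs_mul, abs_sgn, abs_sgn, abs_of_nonneg h0]
        linarith
      nlinarith [mul_nonneg hp (hW z y)]
    rw [← sq_abs]
    nlinarith [abs_nonneg (outCorr μ W v i y)]
  refine (Finset.sum_le_sum fun y _ => hle y).trans ?_
  rw [← Finset.mul_sum, sum_outMass hW1]
  norm_num

/-- The correlations with all coordinates are bounded by the number of bits of the message: the
moment generating function of the input is sub-Gaussian, and Jensen's inequality is applied to the
joint law of input and message. -/
theorem sum_sum_outCorr_sq_div_le_bits {r : ℕ} (hY : Fintype.card Y = 2 ^ r) (h0 : 0 ≤ μ)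
    (h1 : μ < 1) {W : (Fin d → Bool) → Y → ℝ} (hW : ∀ z y, 0 ≤ W z y)
    (hW1 : ∀ z, ∑ y, W z y = 1) (v : Fin d → Bool) :
    ∑ y, ∑ i, outCorr μ W v i y ^ 2 / outMass μ W v y ≤ 3 * r := by
  set q := outMass μ W v with hq
  set m := outCorr μ W v with hm
  -- `a y` is the conditional mean of the centred input given message `y`. In `L` the linear form is
  -- taken in direction `λ • a y`, less its sub-Gaussian cost; `λ = 1 / 2` maximizes `λ - λ ^ 2`,
  -- whence the factor `1 / 4` in `hmean`.
  set a : Y → Fin d → ℝ := fun y i => m i y / q y with ha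
  set L : (Fin d → Bool) → Y → ℝ := fun z y =>
    ∑ i, (1 / 2 * a y i) * (sgn (z i) - μ * sgn (v i)) - ∑ i, (1 / 2 * a y i) ^ 2 with hL
  have hp : ∀ z, 0 ≤ prodMass μ v z := fun z => (prodMass_pos h0 h1 v z).le
  have hle1 : ∀ z y, W z y ≤ 1 := fun z y =>
    (Finset.single_le_sum (f := fun y => W z y) (fun y _ => hW z y) (Finset.mem_univ y)).trans
      (hW1 z).le
  have hmass : ∑ x : (Fin d → Bool) × Y, prodMass μ v x.1 * W x.1 x.2 = 1 := by
    rw [Fintype.sum_prod_type]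
    simp_rw [← Finset.mul_sum, hW1, mul_one]
    exact sum_prodMass μ v
  have hmean : ∑ x : (Fin d → Bool) × Y, prodMass μ v x.1 * W x.1 x.2 * L x.1 x.2
      = 1 / 4 * ∑ y, ∑ i, m i y ^ 2 / q y := by
    rw [Fintype.sum_prod_type, Finset.sum_comm, Finset.mul_sum]
    refine Finset.sum_congr rfl fun y _ => ?_
    have e1 : ∀ z, prodMass μ v z * W z y * L z y
        = (∑ i, 1 / 2 * a y i * (prodMass μ v z * (sgn (z i) - μ * sgn (v i)) * W z y))
          - (∑ i, (1 / 2 * a y i) ^ 2) * (prodMass μ v z * W z y) := by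
      intro z
      simp only [hL]
      rw [mul_sub, Finset.mul_sum]
      congr 1
      · exact Finset.sum_congr rfl fun i _ => by ring
      · ring
    simp only [e1]
    rw [Finset.sum_sub_distrib, Finset.sum_comm, ← Finset.mul_sum]
    simp only [← Finset.mul_sum]
    change (∑ i, 1 / 2 * a y i * m i y) - (∑ i, (1 / 2 * a y i) ^ 2) * q y = _
    rw [Finset.sum_mul, ← Finset.sum_sub_distrib, Finset.mul_sum]
    refine Finset.sum_congr rfl fun i _ => ?_
    simp only [ha]
    -- For a message of mass zero both sides vanish, since division by zero gives `0`.
    by_cases h : q y = 0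
    · simp [h]
    · field_simp
      ring
  have hexp : ∑ x : (Fin d → Bool) × Y, prodMass μ v x.1 * W x.1 x.2 * Real.exp (L x.1 x.2)
      ≤ 2 ^ r := by
    rw [Fintype.sum_prod_type, Finset.sum_comm]
    -- Bounding `W z y` by `1` leaves at most `1` per message, hence `2 ^ r` in total: this is where
    -- the number of bits enters.
    have : ∀ y ∈ (Finset.univ : Finset Y),
        ∑ z, prodMass μ v z * W z y * Real.exp (L z y) ≤ 1 := by
      intro y _
      calc ∑ z, prodMass μ v z * W z y * Real.exp (L z y)
          ≤ ∑ z, prodMass μ v z * Real.exp (L z y) := by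
            refine Finset.sum_le_sum fun z _ => ?_
            refine mul_le_mul_of_nonneg_right ?_ (Real.exp_pos _).le
            exact mul_le_of_le_one_right (hp z) (hle1 z y)
        _ = (∑ z, prodMass μ v z
              * Real.exp (∑ i, (1 / 2 * a y i) * (sgn (z i) - μ * sgn (v i))))
              * Real.exp (-∑ i, (1 / 2 * a y i) ^ 2) := by
            rw [Finset.sum_mul]
            refine Finset.sum_congr rfl fun z _ => ?_
            rw [mul_assoc, ← Real.exp_add, ← sub_eq_add_neg]
        _ ≤ Real.exp (∑ i, (1 / 2 * a y i) ^ 2) * Real.exp (-∑ i, (1 / 2 * a y i) ^ 2) :=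
            mul_le_mul_of_nonneg_right (sum_prodMass_mul_exp_le h0 h1 v _) (Real.exp_pos _).le
        _ = 1 := by rw [← Real.exp_add, add_neg_cancel, Real.exp_zero]
    refine (Finset.sum_le_sum this).trans ?_
    simp [hY]
  have jensen := convexOn_exp.map_sum_le (t := Finset.univ)
    (w := fun x : (Fin d → Bool) × Y => prodMass μ v x.1 * W x.1 x.2) (p := fun x => L x.1 x.2)
    (fun x _ => mul_nonneg (hp x.1) (hW x.1 x.2)) hmass (fun _ _ => Set.mem_univ _)
  simp only [smul_eq_mul] at jensen
  rw [hmean] at jensen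
  have h := Real.log_le_log (Real.exp_pos _) (jensen.trans hexp)
  rw [Real.log_exp, Real.log_pow] at h
  -- The bound obtained is `4 * r * log 2`, and `4 * log 2 < 3`.
  have hlog := Real.log_two_lt_d9
  have hr : (0 : ℝ) ≤ r := Nat.cast_nonneg r
  nlinarith

/-- The average information of one message, in terms of dimension and number of bits. -/
theorem sum_sum_outCorr_sq_div_le {r : ℕ} (hY : Fintype.card Y = 2 ^ r) (h0 : 0 ≤ μ)
    (h1 : μ ≤ 1 / 2) {W : (Fin d → Bool) → Y → ℝ} (hW : ∀ z y, 0 ≤ W z y)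
    (hW1 : ∀ z, ∑ y, W z y = 1) (v : Fin d → Bool) :
    ∑ i, ∑ y, outCorr μ W v i y ^ 2 / outMass μ W v y ≤ 3 * (min d r : ℕ) := by
  rcases le_total d r with h | h
  · rw [min_eq_left h]
    refine (Finset.sum_le_sum fun i _ => sum_outCorr_sq_div_le h0 h1 hW hW1 v i).trans ?_
    simp [mul_comm]
  · rw [min_eq_right h, Finset.sum_comm]
    exact sum_sum_outCorr_sq_div_le_bits hY h0 (by linarith) hW hW1 v

end Bias

/-! ### Hellinger distance between laws of adaptive transcripts. -/

section Path

variable {Y : Type} {T : ℕ}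

/-- The mass of a path whose steps have the conditional masses `k`. -/
noncomputable def pathMass (k : (t : Fin T) → (Fin t → Y) → Y → ℝ) (y : Fin T → Y) : ℝ :=
  ∏ t, k t (past y t) (y t)

theorem past_snoc_castSucc (y : Fin T → Y) (a : Y) (t : Fin T) :
    past (Fin.snoc (α := fun _ => Y) y a) t.castSucc = past y t := by
  funext s
  exact Fin.snoc_castSucc (α := fun _ => Y) a y (Fin.castLE t.isLt.le s)

theorem past_snoc_last (y : Fin T → Y) (a : Y) :
    past (Fin.snoc (α := fun _ => Y) y a) (Fin.last T) = y := by
  funext s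
  exact Fin.snoc_castSucc (α := fun _ => Y) a y s

theorem pathMass_snoc (k : (t : Fin (T + 1)) → (Fin t → Y) → Y → ℝ) (y : Fin T → Y) (a : Y) :
    pathMass k (Fin.snoc (α := fun _ => Y) y a)
      = pathMass (fun t : Fin T => k t.castSucc) y * k (Fin.last T) y a := by
  unfold pathMass
  rw [Fin.prod_univ_castSucc, past_snoc_last, Fin.snoc_last]
  congr 1
  refine Finset.prod_congr rfl fun t _ => ?_
  rw [past_snoc_castSucc, Fin.snoc_castSucc]

theorem pathMass_nonneg {k : (t : Fin T) → (Fin t → Y) → Y → ℝ} (hk : ∀ t h y, 0 ≤ k t h y)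
    (y : Fin T → Y) : 0 ≤ pathMass k y :=
  Finset.prod_nonneg fun _ _ => hk _ _ _

variable [Fintype Y]

theorem sum_snoc (F : (Fin (T + 1) → Y) → ℝ) :
    ∑ y, F y = ∑ y : Fin T → Y, ∑ a, F (Fin.snoc (α := fun _ => Y) y a) := by
  rw [← Equiv.sum_comp (Fin.snocEquiv fun _ => Y) F, Fintype.sum_prod_type, Finset.sum_comm]
  rfl

theorem sum_pathMass {T : ℕ} {k : (t : Fin T) → (Fin t → Y) → Y → ℝ}
    (hk1 : ∀ t h, ∑ y, k t h y = 1) : ∑ y, pathMass k y = 1 := by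
  induction T with
  | zero => simp [pathMass]
  | succ T ih =>
    rw [sum_snoc]
    simp_rw [pathMass_snoc, ← Finset.mul_sum]
    rw [← ih (k := fun t : Fin T => k t.castSucc) fun t h => hk1 t.castSucc h]
    refine Finset.sum_congr rfl fun y _ => ?_
    rw [show ∑ a, k (Fin.last T) y a = 1 from hk1 (Fin.last T) y, mul_one]

/-- Twice the squared Hellinger distance of two mass functions. -/
noncomputable def hellingerSq {ι : Type} [Fintype ι] (P Q : ι → ℝ) : ℝ :=
  ∑ x, (√(P x) - √(Q x)) ^ 2

theorem hellingerSq_comm {ι : Type} [Fintype ι] (P Q : ι → ℝ) :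
    hellingerSq P Q = hellingerSq Q P :=
  Finset.sum_congr rfl fun _ _ => by ring

/-- Hellinger against chi-square: `P - Q` factors as `(√P - √Q) * (√P + √Q)`, and `(√P + √Q) ^ 2 ≥
P`. The support hypothesis excludes terms where division by zero would hide mass of `Q`. -/
theorem hellingerSq_le {ι : Type} [Fintype ι] {P Q : ι → ℝ} (hP : ∀ x, 0 ≤ P x)
    (hQ : ∀ x, 0 ≤ Q x) (h : ∀ x, P x = 0 → Q x = 0) :
    hellingerSq P Q ≤ ∑ x, (P x - Q x) ^ 2 / P x := by
  refine Finset.sum_le_sum fun x _ => ?_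
  rcases (hP x).eq_or_lt with h0 | h0
  · simp [← h0, h x h0.symm]
  · rw [le_div_iff₀ h0]
    have e1 := Real.sq_sqrt (hP x)
    have e2 := Real.sq_sqrt (hQ x)
    have s1 := Real.sqrt_nonneg (P x)
    have s2 := Real.sqrt_nonneg (Q x)
    set a := √(P x)
    set b := √(Q x)
    rw [← e1, ← e2]
    have : (a ^ 2 - b ^ 2) ^ 2 = (a - b) ^ 2 * (a + b) ^ 2 := by ring
    rw [this]
    exact mul_le_mul_of_nonneg_left (by nlinarith) (sq_nonneg _)

/-- Total variation against Hellinger distance. -/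
theorem sum_abs_sub_le {ι : Type} [Fintype ι] {P Q : ι → ℝ} (hP : ∀ x, 0 ≤ P x)
    (hQ : ∀ x, 0 ≤ Q x) (hP1 : ∑ x, P x = 1) (hQ1 : ∑ x, Q x = 1) :
    1 / 2 * ∑ x, |P x - Q x| ≤ 1 / 10 + 5 / 2 * hellingerSq P Q := by
  -- AM-GM on `|√P - √Q| * (√P + √Q)`, weighted to keep the bound linear in the Hellinger term, so
  -- that it can be summed over coordinates and parameters.
  have hx : ∀ x, |P x - Q x| ≤ 1 / 10 * (P x + Q x) + 5 * (√(P x) - √(Q x)) ^ 2 := by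
    intro x
    have e1 := Real.sq_sqrt (hP x)
    have e2 := Real.sq_sqrt (hQ x)
    set a := √(P x)
    set b := √(Q x)
    rw [← e1, ← e2]
    refine abs_le.2 ⟨?_, ?_⟩ <;>
      nlinarith [sq_nonneg ((a + b) + 10 * (a - b)), sq_nonneg ((a + b) - 10 * (a - b)),
        sq_nonneg (a - b)]
  have := Finset.sum_le_sum fun x (_ : x ∈ Finset.univ) => hx x
  rw [Finset.sum_add_distrib, ← Finset.mul_sum, Finset.sum_add_distrib, hP1, hQ1,
    ← Finset.mul_sum] at this
  unfold hellingerSq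
  linarith

/-- One step of the chain rule: the affinity of the products is `√P * √Q` times that of `k` and `l`,
and `√P * √Q ≤ (P + Q) / 2`. -/
theorem sum_sq_sub_sqrt_mul {P Q : ℝ} (hP : 0 ≤ P) (hQ : 0 ≤ Q) {k l : Y → ℝ}
    (hk : ∀ y, 0 ≤ k y) (hl : ∀ y, 0 ≤ l y) (hk1 : ∑ y, k y = 1) (hl1 : ∑ y, l y = 1) :
    ∑ a, (√(P * k a) - √(Q * l a)) ^ 2 ≤ (√P - √Q) ^ 2 + (P + Q) / 2 * hellingerSq k l := by
  have e : ∀ a, (√(P * k a) - √(Q * l a)) ^ 2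
      = (P - √P * √Q) * k a + (Q - √P * √Q) * l a + √P * √Q * (√(k a) - √(l a)) ^ 2 := by
    intro a
    rw [Real.sqrt_mul hP, Real.sqrt_mul hQ]
    have e1 := Real.sq_sqrt hP
    have e2 := Real.sq_sqrt hQ
    have e3 := Real.sq_sqrt (hk a)
    have e4 := Real.sq_sqrt (hl a)
    linear_combination √(k a) ^ 2 * e1 + √(l a) ^ 2 * e2 + (P - √P * √Q) * e3
      + (Q - √P * √Q) * e4
  simp_rw [e]
  rw [Finset.sum_add_distrib, Finset.sum_add_distrib, ← Finset.mul_sum, ← Finset.mul_sum,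
    ← Finset.mul_sum, hk1, hl1]
  change _ + √P * √Q * hellingerSq k l ≤ _
  have hH : 0 ≤ hellingerSq k l := Finset.sum_nonneg fun _ _ => sq_nonneg _
  have h1 : √P * √Q ≤ (P + Q) / 2 := by
    nlinarith [sq_nonneg (√P - √Q), Real.sq_sqrt hP, Real.sq_sqrt hQ]
  have := mul_le_mul_of_nonneg_right h1 hH
  nlinarith [Real.sq_sqrt hP, Real.sq_sqrt hQ]

/-- The squared Hellinger distance of two path laws is at most the expected sum of the conditional
squared Hellinger distances, under the average of the two laws. -/
theorem hellingerSq_pathMass_le {T : ℕ} {k l : (t : Fin T) → (Fin t → Y) → Y → ℝ}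
    (hk : ∀ t h y, 0 ≤ k t h y) (hl : ∀ t h y, 0 ≤ l t h y)
    (hk1 : ∀ t h, ∑ y, k t h y = 1) (hl1 : ∀ t h, ∑ y, l t h y = 1) :
    hellingerSq (pathMass k) (pathMass l)
      ≤ ∑ y, (pathMass k y + pathMass l y) / 2
          * ∑ t, hellingerSq (k t (past y t)) (l t (past y t)) := by
  induction T with
  | zero => simp [pathMass, hellingerSq]
  | succ T ih =>
    specialize ih (k := fun t : Fin T => k t.castSucc) (l := fun t : Fin T => l t.castSucc)
      (fun t h y => hk t.castSucc h y) (fun t h y => hl t.castSucc h y)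
      (fun t h => hk1 t.castSucc h) (fun t h => hl1 t.castSucc h)
    set K : (Fin T → Y) → ℝ := pathMass fun t : Fin T => k t.castSucc with hK
    set L : (Fin T → Y) → ℝ := pathMass fun t : Fin T => l t.castSucc with hL
    have hK0 : ∀ y, 0 ≤ K y := pathMass_nonneg fun t h y => hk t.castSucc h y
    have hL0 : ∀ y, 0 ≤ L y := pathMass_nonneg fun t h y => hl t.castSucc h y
    set η : (Fin T → Y) → ℝ := fun y => hellingerSq (k (Fin.last T) y) (l (Fin.last T) y) with hη
    have lhs : hellingerSq (pathMass k) (pathMass l)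
        ≤ ∑ y, ((√(K y) - √(L y)) ^ 2 + (K y + L y) / 2 * η y) := by
      unfold hellingerSq
      rw [sum_snoc]
      refine Finset.sum_le_sum fun y _ => ?_
      simp_rw [pathMass_snoc]
      exact sum_sq_sub_sqrt_mul (hK0 y) (hL0 y) (hk (Fin.last T) y) (hl (Fin.last T) y)
        (hk1 (Fin.last T) y) (hl1 (Fin.last T) y)
    have rhs : ∑ y, (pathMass k y + pathMass l y) / 2
          * ∑ t, hellingerSq (k t (past y t)) (l t (past y t))
        = ∑ y : Fin T → Y, ((K y + L y) / 2 * (∑ t : Fin T,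
            hellingerSq (k t.castSucc (past y t)) (l t.castSucc (past y t)))
            + (K y + L y) / 2 * η y) := by
      rw [sum_snoc]
      refine Finset.sum_congr rfl fun y _ => ?_
      have e : ∀ a, (∑ t, hellingerSq (k t (past (Fin.snoc (α := fun _ => Y) y a) t))
            (l t (past (Fin.snoc (α := fun _ => Y) y a) t)))
          = (∑ t : Fin T, hellingerSq (k t.castSucc (past y t)) (l t.castSucc (past y t)))
            + η y := by
        intro a
        rw [Fin.sum_univ_castSucc]
        simp only [past_snoc_castSucc, past_snoc_last]
        rfl
      simp_rw [e, pathMass_snoc]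
      rw [← Finset.sum_mul, ← Finset.sum_div, Finset.sum_add_distrib, ← Finset.mul_sum,
        ← Finset.mul_sum, show ∑ a, k (Fin.last T) y a = 1 from hk1 (Fin.last T) y,
        show ∑ a, l (Fin.last T) y a = 1 from hl1 (Fin.last T) y, mul_one, mul_one, mul_add]
    rw [rhs, Finset.sum_add_distrib]
    refine lhs.trans ?_
    rw [Finset.sum_add_distrib]
    exact add_le_add_left ih _

end Path

/-! ### Assouad's argument. -/

/-- **Assouad's argument** for adaptively chosen `r`-bit channels `W`, applied to samples of the
product law with mean `μ • v`: no function of the transcript correlates well with all the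
coordinates of the parameter `v`. -/
theorem le_sum_pathMass_mul {d r T : ℕ} {Y : Type} [Fintype Y] (hY : Fintype.card Y = 2 ^ r)
    {μ : ℝ} (h0 : 0 ≤ μ) (h1 : μ ≤ 1 / 3) (hμ : 75 * (T * (min d r : ℕ) * μ ^ 2) ≤ d)
    {W : (t : Fin T) → (Fin t → Y) → (Fin d → Bool) → Y → ℝ} (hW : ∀ t h z y, 0 ≤ W t h z y)
    (hW1 : ∀ t h z, ∑ y, W t h z y = 1) (x : (Fin T → Y) → Fin d → ℝ) (hx : ∀ y i, |x y i| ≤ 1) :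
    2 ^ d * (1 / 4 * (d : ℝ)) ≤ ∑ v : Fin d → Bool, ∑ y,
      pathMass (fun t h => outMass μ (W t h) v) y * ∑ i, (1 - sgn (v i) * x y i) := by
  have hlt : μ < 1 := by linarith
  set P : (Fin d → Bool) → (Fin T → Y) → ℝ :=
    fun v => pathMass fun t h => outMass μ (W t h) v with hP
  have hk : ∀ v t h y, 0 ≤ outMass μ (W t h) v y := fun v t h y =>
    outMass_nonneg h0 hlt (hW t h) v y
  have hk1 : ∀ v t h, ∑ y, outMass μ (W t h) v y = 1 := fun v t h => sum_outMass (hW1 t h) v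
  have hP0 : ∀ v y, 0 ≤ P v y := fun v => pathMass_nonneg (hk v)
  have hP1 : ∀ v, ∑ y, P v y = 1 := fun v => sum_pathMass (hk1 v)
  have step : ∀ v t h, ∑ i, hellingerSq (outMass μ (W t h) v) (outMass μ (W t h) (flipAt i v))
      ≤ 6 * μ ^ 2 * (3 * (min d r : ℕ)) := by
    intro v t h
    -- From `μ ≤ 1 / 3` the left side is at most `4 * (81 / 64) * μ ^ 2`.
    have hK : (2 * μ / (1 - μ ^ 2)) ^ 2 ≤ 6 * μ ^ 2 := by
      have hμ2 : μ ^ 2 ≤ 1 / 9 := by nlinarith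
      rw [div_pow, div_le_iff₀ (by nlinarith)]
      have : (64 : ℝ) / 81 ≤ (1 - μ ^ 2) ^ 2 := by nlinarith
      nlinarith [sq_nonneg μ]
    calc ∑ i, hellingerSq (outMass μ (W t h) v) (outMass μ (W t h) (flipAt i v))
        ≤ ∑ i, ∑ y, (2 * μ / (1 - μ ^ 2)) ^ 2
            * (outCorr μ (W t h) v i y ^ 2 / outMass μ (W t h) v y) := by
          refine Finset.sum_le_sum fun i _ => ?_
          refine (hellingerSq_le (hk v t h) (hk _ t h) ?_).trans (Finset.sum_le_sum fun y _ => ?_)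
          -- Since `prodMass` is positive everywhere, whether a message has mass zero depends on `W`
          -- alone, not on `v`.
          · intro y hy
            have hz := (Finset.sum_eq_zero_iff_of_nonneg fun z _ =>
              mul_nonneg (prodMass_pos h0 hlt v z).le (hW t h z y)).1 hy
            refine Finset.sum_eq_zero fun z hzu => ?_
            rcases mul_eq_zero.1 (hz z hzu) with h' | h'
            · exact absurd h' (prodMass_pos h0 hlt v z).ne'
            · rw [h', mul_zero]
          · rw [outMass_sub_flipAt h0 hlt, mul_pow, mul_pow, sq (sgn (v i)), sgn_mul_self, mul_one,
              mul_div_assoc]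
      _ = (2 * μ / (1 - μ ^ 2)) ^ 2
            * ∑ i, ∑ y, outCorr μ (W t h) v i y ^ 2 / outMass μ (W t h) v y := by
          simp_rw [Finset.mul_sum]
      _ ≤ 6 * μ ^ 2 * (3 * (min d r : ℕ)) :=
          mul_le_mul hK (sum_sum_outCorr_sq_div_le hY h0 (by linarith) (hW t h) (hW1 t h) v)
            (Finset.sum_nonneg fun i _ => Finset.sum_nonneg fun y _ =>
              div_nonneg (sq_nonneg _) (hk v t h y)) (by positivity)
  set η : (Fin d → Bool) → Fin d → (Fin T → Y) → ℝ := fun v i y =>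
    ∑ t, hellingerSq (outMass μ (W t (past y t)) v) (outMass μ (W t (past y t)) (flipAt i v))
    with hη
  have hηsymm : ∀ v i y, η (flipAt i v) i y = η v i y := by
    intro v i y
    refine Finset.sum_congr rfl fun t _ => ?_
    rw [flipAt_involutive i v, hellingerSq_comm]
  have hHsum : ∑ i, ∑ v, hellingerSq (P v) (P (flipAt i v))
      ≤ 2 ^ d * (T * (6 * μ ^ 2 * (3 * (min d r : ℕ)))) := by
    calc ∑ i, ∑ v, hellingerSq (P v) (P (flipAt i v))
        ≤ ∑ i, ∑ v, ∑ y, (P v y + P (flipAt i v) y) / 2 * η v i y :=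
          Finset.sum_le_sum fun i _ => Finset.sum_le_sum fun v _ =>
            hellingerSq_pathMass_le (hk v) (hk _) (hk1 v) (hk1 _)
      -- `η` is invariant under the flip, so reindexing `v` turns the half-weight on the flipped law
      -- into a half-weight on `P v`. A single law then serves all coordinates.
      _ = ∑ i, ∑ v, ∑ y, P v y * η v i y := by
          refine Finset.sum_congr rfl fun i _ => ?_
          have := sum_flipAt i fun v => ∑ y, P v y * η v i y
          simp only [hηsymm] at this
          have e : ∀ v, ∑ y, (P v y + P (flipAt i v) y) / 2 * η v i y
              = 1 / 2 * (∑ y, P v y * η v i y) + 1 / 2 * ∑ y, P (flipAt i v) y * η v i y := by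
            intro v
            rw [Finset.mul_sum, Finset.mul_sum, ← Finset.sum_add_distrib]
            exact Finset.sum_congr rfl fun y _ => by ring
          simp only [e]
          rw [Finset.sum_add_distrib, ← Finset.mul_sum, ← Finset.mul_sum, this]
          ring
      _ = ∑ v, ∑ y, P v y * ∑ i, η v i y := by
          rw [Finset.sum_comm]
          refine Finset.sum_congr rfl fun v _ => ?_
          rw [Finset.sum_comm]
          simp_rw [Finset.mul_sum]
      _ ≤ ∑ v : Fin d → Bool, ∑ y, P v y * (T * (6 * μ ^ 2 * (3 * (min d r : ℕ)))) := by
          refine Finset.sum_le_sum fun v _ => Finset.sum_le_sum fun y _ => ?_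
          refine mul_le_mul_of_nonneg_left ?_ (hP0 v y)
          simp only [hη]
          rw [Finset.sum_comm]
          refine (Finset.sum_le_sum fun t _ => step v t (past y t)).trans ?_
          simp
      _ = 2 ^ d * (T * (6 * μ ^ 2 * (3 * (min d r : ℕ)))) := by
          simp_rw [← Finset.sum_mul, hP1]
          simp
  have hcoord : ∀ i, ∑ v, ∑ y, P v y * (sgn (v i) * x y i)
      ≤ ∑ v, (1 / 10 + 5 / 2 * hellingerSq (P v) (P (flipAt i v))) := by
    intro i
    have hflip := sum_flipAt i fun v => ∑ y, P v y * (sgn (v i) * x y i)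
    -- Pairing `v` with its flip reverses the sign of the summand's coefficient, which leaves a
    -- difference of laws controlled by total variation.
    have e : ∑ v, ∑ y, P v y * (sgn (v i) * x y i)
        = ∑ v, 1 / 2 * ∑ y, (P v y - P (flipAt i v) y) * (sgn (v i) * x y i) := by
      have e' : ∀ v, 1 / 2 * ∑ y, (P v y - P (flipAt i v) y) * (sgn (v i) * x y i)
          = 1 / 2 * (∑ y, P v y * (sgn (v i) * x y i))
            + 1 / 2 * ∑ y, P (flipAt i v) y * (sgn (flipAt i v i) * x y i) := by
        intro v
        rw [← mul_add, ← Finset.sum_add_distrib, sgn_flipAt_self]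
        congr 1
        exact Finset.sum_congr rfl fun y _ => by ring
      simp only [e']
      rw [Finset.sum_add_distrib, ← Finset.mul_sum, ← Finset.mul_sum, hflip]
      ring
    rw [e]
    refine Finset.sum_le_sum fun v _ => ?_
    refine le_trans ?_ (sum_abs_sub_le (hP0 v) (hP0 _) (hP1 v) (hP1 _))
    refine mul_le_mul_of_nonneg_left (Finset.sum_le_sum fun y _ => ?_) (by norm_num)
    refine (le_abs_self _).trans ?_
    rw [abs_mul, abs_mul, abs_sgn, one_mul]
    exact mul_le_of_le_one_right (abs_nonneg _) (hx y i)
  have hmain : ∑ v, ∑ y, P v y * ∑ i, (1 - sgn (v i) * x y i)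
      = 2 ^ d * d - ∑ i, ∑ v, ∑ y, P v y * (sgn (v i) * x y i) := by
    have e : ∀ v, ∑ y, P v y * ∑ i, (1 - sgn (v i) * x y i)
        = d - ∑ i, ∑ y, P v y * (sgn (v i) * x y i) := by
      intro v
      rw [Finset.sum_comm]
      have : ∀ y, P v y * ∑ i, (1 - sgn (v i) * x y i)
          = P v y * d - ∑ i, P v y * (sgn (v i) * x y i) := by
        intro y
        rw [Finset.sum_sub_distrib, mul_sub, ← Finset.mul_sum]
        simp
      simp only [this]
      rw [Finset.sum_sub_distrib, ← Finset.sum_mul, hP1, one_mul]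
    simp only [e]
    rw [Finset.sum_sub_distrib, Finset.sum_comm]
    simp
  rw [hmain]
  have htot := Finset.sum_le_sum fun i (_ : i ∈ Finset.univ) => hcoord i
  simp only [Finset.sum_add_distrib, ← Finset.mul_sum] at htot
  simp only [Finset.sum_const, Finset.card_univ, Fintype.card_pi, Fintype.card_bool,
    Finset.prod_const, Fintype.card_fin, nsmul_eq_mul] at htot
  push_cast at htot
  have h2 : (0 : ℝ) < 2 ^ d := by positivity
  have := mul_le_mul_of_nonneg_left hμ h2.le
  push_cast at hHsum this
  -- Per vertex, the loss is `d / 10` plus `5 / 2 * 18 = 45` times `T * min d r * μ ^ 2`, at most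
  -- `45 / 75 * d`. What remains, `3 / 10 * d`, exceeds `d / 4`.
  nlinarith

/-! ### Norm bounds and the cube as domain. -/

theorem ellNorm_nonneg {d : ℕ} {p : ℝ≥0∞} (hp : 1 ≤ p) (x : Fin d → ℝ) : 0 ≤ ellNorm p x :=
  have : Fact (1 ≤ p) := ⟨hp⟩
  norm_nonneg (WithLp.toLp p x)

theorem ellNorm_le_of_forall_abs_le {d : ℕ} {p : ℝ≥0∞} (hp : 1 ≤ p) {x : Fin d → ℝ} {c : ℝ}
    (hc : 0 ≤ c) (hx : ∀ i, |x i| ≤ c) : ellNorm p x ≤ (d : ℝ) ^ p⁻¹.toReal * c := by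
  unfold ellNorm
  rcases eq_or_ne p ∞ with rfl | htop
  · rw [PiLp.norm_eq_ciSup]
    simpa using Real.iSup_le hx hc
  · have hp0 : 0 < p.toReal := ENNReal.toReal_pos (by positivity) htop
    rw [PiLp.norm_eq_sum hp0, ENNReal.toReal_inv, ← one_div]
    calc (∑ i, ‖x i‖ ^ p.toReal) ^ (1 / p.toReal)
        ≤ (∑ _i : Fin d, c ^ p.toReal) ^ (1 / p.toReal) := by
          refine Real.rpow_le_rpow (Finset.sum_nonneg fun i _ => by positivity)
            (Finset.sum_le_sum fun i _ => ?_) (by positivity)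
          exact Real.rpow_le_rpow (norm_nonneg _) (hx i) hp0.le
      _ = (d : ℝ) ^ (1 / p.toReal) * c := by
          rw [Finset.sum_const, Finset.card_univ, Fintype.card_fin, nsmul_eq_mul,
            Real.mul_rpow (by positivity) (by positivity), ← Real.rpow_mul hc,
            mul_one_div_cancel hp0.ne', Real.rpow_one]

/-- The cube `[-b, b]^d`. -/
def cube (d : ℕ) (b : ℝ) : Set (Fin d → ℝ) := Set.Icc (fun _ => -b) fun _ => b

theorem abs_le_of_mem_cube {d : ℕ} {b : ℝ} {x : Fin d → ℝ} (hx : x ∈ cube d b) (i : Fin d) :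
    |x i| ≤ b := abs_le.2 ⟨hx.1 i, hx.2 i⟩

theorem cube_mem_domains {d : ℕ} {p : ℝ≥0∞} (hp : 1 ≤ p) {b D : ℝ} (hb : 0 ≤ b)
    (h : (d : ℝ) ^ p⁻¹.toReal * (2 * b) ≤ D) : cube d b ∈ domains d p D := by
  refine ⟨⟨0, fun _ => neg_nonpos.2 hb, fun _ => hb⟩, convex_Icc _ _, isCompact_Icc,
    fun x hx y hy => (ellNorm_le_of_forall_abs_le hp (by positivity) fun i => ?_).trans h⟩
  have := abs_le_of_mem_cube hx i
  have := abs_le_of_mem_cube hy i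
  exact (abs_sub (x i) (y i)).trans (by linarith)

/-! ### The hard oracles and their linear objectives. -/

/-- The answer `-β • z` of the oracle. -/
noncomputable def answer {d : ℕ} (β : ℝ) (z : Fin d → Bool) : Fin d → ℝ :=
  fun i => -β * sgn (z i)

/-- The law of `-β • z`, where `z` has the product law on `{±1}^d` with mean `μ • v`. -/
noncomputable def answerLaw {d : ℕ} (β μ : ℝ) (v : Fin d → Bool) : Measure (Fin d → ℝ) :=
  ∑ z, ENNReal.ofReal (prodMass μ v z) • Measure.dirac (answer β z)

section Oracle

variable {d : ℕ} {β μ : ℝ}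

theorem isProbabilityMeasure_answerLaw (h0 : 0 ≤ μ) (h1 : μ < 1) (v : Fin d → Bool) :
    IsProbabilityMeasure (answerLaw β μ v) := by
  constructor
  simp only [answerLaw, Measure.coe_finsetSum, Finset.sum_apply, Measure.smul_apply,
    measure_univ, smul_eq_mul, mul_one]
  rw [← ENNReal.ofReal_sum_of_nonneg fun z _ => (prodMass_pos h0 h1 v z).le, sum_prodMass,
    ENNReal.ofReal_one]

theorem integral_answerLaw (h0 : 0 ≤ μ) (h1 : μ < 1) (v : Fin d → Bool) :
    ∫ g, g ∂(answerLaw β μ v) = fun i => -β * μ * sgn (v i) := by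
  unfold answerLaw
  rw [integral_finsetSum_measure fun z _ =>
    (integrable_dirac (by simp)).smul_measure ENNReal.ofReal_ne_top]
  simp only [integral_smul_measure, integral_dirac, ENNReal.toReal_ofReal,
    (prodMass_pos h0 h1 v _).le]
  funext i
  rw [Finset.sum_apply]
  simp only [Pi.smul_apply, smul_eq_mul, answer]
  rw [mul_assoc, ← sum_prodMass_mul_sgn, Finset.mul_sum]
  exact Finset.sum_congr rfl fun z _ => by ring

theorem ae_answerLaw {P : (Fin d → ℝ) → Prop} (hP : ∀ z, P (answer β z)) (v : Fin d → Bool) :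
    ∀ᵐ g ∂(answerLaw β μ v), P g := by
  unfold answerLaw
  rw [ae_finsetSum_measure_iff]
  intro z _
  refine Measure.ae_smul_measure ?_ _
  rw [ae_dirac_eq]
  exact hP z

theorem bind_answerLaw_singleton {Y : Type} [MeasurableSpace Y] [MeasurableSingletonClass Y]
    [Fintype Y] (h0 : 0 ≤ μ) (h1 : μ < 1) (v : Fin d → Bool) (W : Kernel (Fin d → ℝ) Y)
    [IsMarkovKernel W] (y : Y) :
    (answerLaw β μ v).bind W {y}
      = ENNReal.ofReal (outMass μ (fun z y => (W (answer β z) {y}).toReal) v y) := by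
  rw [Measure.bind_apply (measurableSet_singleton y) W.measurable.aemeasurable, answerLaw,
    lintegral_finsetSum_measure, outMass, ENNReal.ofReal_sum_of_nonneg fun z _ =>
      mul_nonneg (prodMass_pos h0 h1 v z).le ENNReal.toReal_nonneg]
  refine Finset.sum_congr rfl fun z _ => ?_
  rw [lintegral_smul_measure, lintegral_dirac, smul_eq_mul,
    ENNReal.ofReal_mul (prodMass_pos h0 h1 v z).le, ENNReal.ofReal_toReal (measure_ne_top _ _)]

/-- The linear objective with gradient `-βμ • v`. -/
noncomputable def objective (β μ : ℝ) (v : Fin d → Bool) (x : Fin d → ℝ) : ℝ :=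
  (fun i => -β * μ * sgn (v i)) ⬝ᵥ x

theorem objective_mem_convexOracles {X : Set (Fin d → ℝ)} (hX : Convex ℝ X) {s : ℝ≥0∞}
    {B : ℝ} (hβ : 0 ≤ β) (hB : (d : ℝ) ^ (ENNReal.conjExponent s)⁻¹.toReal * β ≤ B)
    (h0 : 0 ≤ μ) (h1 : μ < 1) (v : Fin d → Bool) :
    (objective β μ v, Kernel.const X (answerLaw β μ v)) ∈ convexOracles X s B := by
  have := isProbabilityMeasure_answerLaw (β := β) h0 h1 v
  refine ⟨⟨hX, fun x _ y _ a b _ _ _ => ?_⟩, by dsimp only; infer_instance, fun x => ⟨?_, ?_⟩⟩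
  · simp only [objective, dotProduct_add, dotProduct_smul, le_refl]
  · rw [Kernel.const_apply]
    refine ae_answerLaw (fun z => ?_) v
    have hq : 1 ≤ ENNReal.conjExponent s := le_self_add
    refine pow_le_pow_left₀ (ellNorm_nonneg hq _)
      ((ellNorm_le_of_forall_abs_le hq hβ fun i => ?_).trans hB) 2
    rw [answer, abs_mul, abs_sgn, abs_neg, abs_of_nonneg hβ, mul_one]
  · rw [Kernel.const_apply, integral_answerLaw h0 h1]
    intro y _
    simp only [objective, dotProduct_sub]
    linarith

theorem continuous_objective (v : Fin d → Bool) : Continuous (objective β μ v) := by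
  unfold objective dotProduct
  fun_prop

theorem le_objective_sub_sInf {b : ℝ} (hb : 0 < b) (v : Fin d → Bool)
    (x : Fin d → ℝ) :
    β * μ * b * ∑ i, (1 - sgn (v i) * (x i / b))
      ≤ objective β μ v x - sInf (objective β μ v '' cube d b) := by
  -- The vertex `b • v` minimizes the objective over the cube; only its membership is needed for
  -- this direction.
  have hmem : (fun i => b * sgn (v i)) ∈ cube d b := by
    constructor <;> intro i <;> have := abs_le.1 (abs_sgn (v i)).le <;> dsimp only <;> nlinarith
  have hbdd : BddBelow (objective β μ v '' cube d b) :=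
    (isCompact_Icc.image (continuous_objective v)).bddBelow
  have h := csInf_le hbdd (Set.mem_image_of_mem _ hmem)
  have e : β * μ * b * ∑ i, (1 - sgn (v i) * (x i / b))
      = objective β μ v x - objective β μ v fun i => b * sgn (v i) := by
    simp only [objective, dotProduct]
    rw [← Finset.sum_sub_distrib, Finset.mul_sum]
    refine Finset.sum_congr rfl fun i _ => ?_
    field_simp
    linear_combination (-β * μ * b) * sgn_mul_self (v i)
  linarith

end Oracle

/-! ### From estimation to minmax error. -/

/-- The minmax error over the cube, for any class of oracles that contains the hard instances. -/
theorem le_minmaxError_cube {d r T : ℕ} {β μ b : ℝ} (hβ : 0 ≤ β) (hb : 0 < b) (h0 : 0 ≤ μ)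
    (h1 : μ ≤ 1 / 3) (hμ : 75 * (T * (min d r : ℕ) * μ ^ 2) ≤ d)
    {𝒪 : Set (((Fin d → ℝ) → ℝ) × Kernel (cube d b) (Fin d → ℝ))}
    (h𝒪 : ∀ v, (objective β μ v, Kernel.const (cube d b) (answerLaw β μ v)) ∈ 𝒪) :
    ENNReal.ofReal (β * μ * b * (1 / 4 * d)) ≤ minmaxError (cube d b) 𝒪 T (commChannels d r) := by
  have hlt : μ < 1 := by linarith
  have hβμb : 0 ≤ β * μ * b := by positivity
  refine le_iInf fun π => le_iInf fun S => ?_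
  set W : (t : Fin T) → (Fin t → Fin r → Bool) → (Fin d → Bool) → (Fin r → Bool) → ℝ :=
    fun t h z y => ((S t h).1 (answer β z) {y}).toReal with hWdef
  have hMarkov : ∀ t h, IsMarkovKernel (S t h).1 := fun t h => (S t h).2
  have hW : ∀ t h z y, 0 ≤ W t h z y := fun _ _ _ _ => ENNReal.toReal_nonneg
  have hW1 : ∀ t h z, ∑ y, W t h z y = 1 := by
    intro t h z
    have := hMarkov t h
    simp only [hWdef]
    rw [← ENNReal.toReal_sum fun y _ => measure_ne_top _ _]
    simp
  set P : (Fin d → Bool) → (Fin T → Fin r → Bool) → ℝ :=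
    fun v => pathMass fun t h => outMass μ (W t h) v with hP
  have hP0 : ∀ v y, 0 ≤ P v y := fun v =>
    pathMass_nonneg fun t h y => outMass_nonneg h0 hlt (hW t h) v y
  -- The oracle ignores the query, so the transcript law does not depend on the seed `u`. Assouad's
  -- bound therefore applies for each fixed seed and is integrated afterwards.
  have htr : ∀ v u y, transcriptProb (Kernel.const (cube d b) (answerLaw β μ v)) π S u y
      = ENNReal.ofReal (P v y) := by
    intro v u y
    simp only [hP, transcriptProb, messageLaw, pathMass, Kernel.const_apply]
    rw [ENNReal.ofReal_prod_of_nonneg fun t _ => outMass_nonneg h0 hlt (hW t _) v _]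
    refine Finset.prod_congr rfl fun t _ => ?_
    have := hMarkov t (past y t)
    exact bind_answerLaw_singleton h0 hlt v _ _
  set G : (Fin d → Bool) → π.Seed → ℝ≥0∞ := fun v u =>
    ∑ y, ENNReal.ofReal (P v y) * ENNReal.ofReal
      (objective β μ v (π.output u y) - sInf (objective β μ v '' cube d b)) with hG
  have hGm : ∀ v, Measurable (G v) := by
    intro v
    refine Finset.measurable_fun_sum _ fun y _ => Measurable.const_mul ?_ _
    refine (Measurable.sub_const ?_ _).ennreal_ofReal
    exact (continuous_objective v).measurable.comp
      (measurable_subtype_coe.comp (π.measurable_output y))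
  have hGsum : ∀ u, ENNReal.ofReal (2 ^ d * (β * μ * b * (1 / 4 * d))) ≤ ∑ v, G v u := by
    intro u
    have hx : ∀ y i, |((π.output u y : Fin d → ℝ) i) / b| ≤ 1 := by
      intro y i
      rw [abs_div, abs_of_pos hb, div_le_one hb]
      exact abs_le_of_mem_cube (π.output u y).2 i
    have key := le_sum_pathMass_mul (d := d) (r := r) (by simp) h0 h1 hμ hW hW1
      (fun y i => (π.output u y : Fin d → ℝ) i / b) hx
    have hnonneg : ∀ v y, 0 ≤ objective β μ v (π.output u y)
        - sInf (objective β μ v '' cube d b) := by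
      intro v y
      refine le_trans ?_ (le_objective_sub_sInf hb v _)
      refine mul_nonneg hβμb (Finset.sum_nonneg fun i _ => sub_nonneg.2 ?_)
      refine (le_abs_self _).trans ?_
      rw [abs_mul, abs_sgn, one_mul]
      exact hx y i
    have e : ∑ v, G v u = ENNReal.ofReal (∑ v, ∑ y, P v y *
        (objective β μ v (π.output u y) - sInf (objective β μ v '' cube d b))) := by
      rw [ENNReal.ofReal_sum_of_nonneg fun v _ => Finset.sum_nonneg fun y _ =>
        mul_nonneg (hP0 v y) (hnonneg v y)]
      refine Finset.sum_congr rfl fun v _ => ?_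
      rw [ENNReal.ofReal_sum_of_nonneg fun y _ => mul_nonneg (hP0 v y) (hnonneg v y)]
      exact Finset.sum_congr rfl fun y _ => (ENNReal.ofReal_mul (hP0 v y)).symm
    rw [e]
    refine ENNReal.ofReal_le_ofReal ?_
    calc 2 ^ d * (β * μ * b * (1 / 4 * d)) = β * μ * b * (2 ^ d * (1 / 4 * d)) := by ring
      _ ≤ _ := mul_le_mul_of_nonneg_left key hβμb
      _ ≤ _ := by
        rw [Finset.mul_sum]
        refine Finset.sum_le_sum fun v _ => ?_
        rw [Finset.mul_sum]
        refine Finset.sum_le_sum fun y _ => ?_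
        rw [mul_left_comm]
        exact mul_le_mul_of_nonneg_left
          (le_objective_sub_sInf hb v _) (hP0 v y)
  have hle : ∀ v, ∫⁻ u, G v u ∂π.law ≤ ⨆ fO ∈ 𝒪, optError fO.1 fO.2 π S := by
    intro v
    refine le_trans (le_of_eq ?_) (le_iSup₂_of_le _ (h𝒪 v) le_rfl)
    simp only [optError, htr, hG]
  -- The supremum dominates each of the `2 ^ d` instances, hence their average; the factor `2 ^ d`
  -- is cancelled at the end.
  have hsum : ENNReal.ofReal (2 ^ d * (β * μ * b * (1 / 4 * d)))
      ≤ ∑ _v : Fin d → Bool, ⨆ fO ∈ 𝒪, optError fO.1 fO.2 π S := by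
    refine le_trans ?_ (Finset.sum_le_sum fun v _ => hle v)
    rw [← lintegral_finsetSum _ fun v _ => hGm v]
    refine le_trans (le_of_eq ?_) (lintegral_mono hGsum)
    simp
  have h2 : (2 : ℝ≥0∞) ^ d ≠ 0 := by positivity
  have h2' : (2 : ℝ≥0∞) ^ d ≠ ∞ := ENNReal.pow_ne_top (by simp)
  rw [ENNReal.ofReal_mul (by positivity), ENNReal.ofReal_pow (by norm_num),
    ENNReal.ofReal_ofNat, Finset.sum_const, nsmul_eq_mul] at hsum
  simp only [Finset.card_univ, Fintype.card_pi, Fintype.card_bool, Finset.prod_const,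
    Fintype.card_fin] at hsum
  push_cast at hsum
  exact (ENNReal.mul_le_mul_iff_right h2 h2').1 hsum

/-! ### Choice of the scales. -/

/-- The lower bound for the oracles of exponent `s`, if the conjugate exponent of `s` is at least
that of the exponent `p` of the domains. -/
theorem le_iSup_minmaxError {d r T : ℕ} (hd : 1 ≤ d) (hr : 1 ≤ r) {p s : ℝ≥0∞} (hp : 1 ≤ p)
    (hsp : (ENNReal.conjExponent s)⁻¹ ≤ (ENNReal.conjExponent p)⁻¹) {D B : ℝ}
    (hD : 0 < D) (hB : 0 < B) (hT : (d : ℝ) / (6 * (r : ℝ)) ≤ T) :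
    ENNReal.ofReal ((1 / (12 * √58)) * (D * B / √(T : ℝ)) * √((d : ℝ) / (min d r : ℕ))) ≤
      ⨆ X ∈ domains d p D, minmaxError X (convexOracles X s B) T (commChannels d r) := by
  have hd' : (1 : ℝ) ≤ d := by exact_mod_cast hd
  have hd0 : (0 : ℝ) < d := by linarith
  have hr0 : (0 : ℝ) < r := by exact_mod_cast hr
  have hT0 : (0 : ℝ) < T := lt_of_lt_of_le (by positivity) hT
  have hT1 : (1 : ℝ) ≤ T := by exact_mod_cast Nat.one_le_iff_ne_zero.2 fun h => by simp [h] at hT0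
  have hm0 : (0 : ℝ) < (min d r : ℕ) := by exact_mod_cast lt_min hd hr
  set m : ℝ := ((min d r : ℕ) : ℝ) with hm
  set σ : ℝ := √(d / m) / √T with hσ
  have hσ0 : 0 ≤ σ := by positivity
  have hσ2 : σ ^ 2 = d / m / T := by
    rw [hσ, div_pow, Real.sq_sqrt (by positivity), Real.sq_sqrt hT0.le]
  -- If `d ≤ r` this only needs `T ≥ 1`; otherwise it is the assumption on `T`. It gives `σ ^ 2 ≤
  -- 6`, which keeps the bias `σ / 9` below `1 / 3`.
  have hdmT : (d : ℝ) ≤ 6 * (m * T) := by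
    rcases le_total d r with h | h
    · rw [hm, min_eq_left h]
      nlinarith
    · rw [hm, min_eq_right h]
      rw [div_le_iff₀ (by positivity)] at hT
      linarith
  set q := ENNReal.conjExponent p with hq
  have hpq : p.HolderConjugate q := ENNReal.HolderConjugate.conjExponent hp
  have hqle : q⁻¹ ≤ 1 := ENNReal.inv_le_one.2 le_self_add
  have hple : p⁻¹ ≤ 1 := ENNReal.inv_le_one.2 hp
  have hexp : p⁻¹.toReal + q⁻¹.toReal = 1 := by
    rw [← ENNReal.toReal_add (ne_top_of_le_ne_top ENNReal.one_ne_top hple)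
      (ne_top_of_le_ne_top ENNReal.one_ne_top hqle),
      ENNReal.HolderConjugate.inv_add_inv_eq_one p q, ENNReal.toReal_one]
  set Np : ℝ := (d : ℝ) ^ p⁻¹.toReal with hNp
  set Nq : ℝ := (d : ℝ) ^ q⁻¹.toReal with hNq
  have hNp0 : 0 < Np := Real.rpow_pos_of_pos hd0 _
  have hNq0 : 0 < Nq := Real.rpow_pos_of_pos hd0 _
  have hNN : Np * Nq = d := by rw [hNp, hNq, ← Real.rpow_add hd0, hexp, Real.rpow_one]
  have hNs : (d : ℝ) ^ (ENNReal.conjExponent s)⁻¹.toReal ≤ Nq :=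
    Real.rpow_le_rpow_of_exponent_le hd'
      (ENNReal.toReal_mono (ne_top_of_le_ne_top ENNReal.one_ne_top hqle) hsp)
  have hb : 0 < D / (2 * Np) := by positivity
  have hβ : 0 ≤ B / Nq := by positivity
  have hμ0 : 0 ≤ σ / 9 := by positivity
  have hμ1 : σ / 9 ≤ 1 / 3 := by
    have : σ ^ 2 ≤ 6 := by
      rw [hσ2, div_div, div_le_iff₀ (by positivity)]
      exact hdmT
    nlinarith
  have hdom : cube d (D / (2 * Np)) ∈ domains d p D := by
    refine cube_mem_domains hp hb.le (le_of_eq ?_)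
    rw [← hNp]
    field_simp
  refine le_trans ?_ (le_iSup₂_of_le _ hdom le_rfl)
  refine le_trans ?_ (le_minmaxError_cube (β := B / Nq) (μ := σ / 9) hβ hb hμ0 hμ1 ?_ fun v =>
    objective_mem_convexOracles hdom.2.1 hβ ?_ hμ0 (by linarith) v)
  · refine ENNReal.ofReal_le_ofReal ?_
    have e1 : B / Nq * (σ / 9) * (D / (2 * Np)) * (1 / 4 * d) = 1 / 72 * (D * B * σ) := by
      rw [← hNN]
      field_simp
      ring
    have e2 : 1 / (12 * √58) * (D * B / √(T : ℝ)) * √((d : ℝ) / m)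
        = 1 / (12 * √58) * (D * B * σ) := by
      rw [hσ]
      ring
    rw [e1, e2]
    refine mul_le_mul_of_nonneg_right ?_ (by positivity)
    refine one_div_le_one_div_of_le (by norm_num) ?_
    -- The construction yields the constant `1 / 72`, which is larger than `1 / (12 * √58)`.
    have : (6 : ℝ) ≤ √58 := Real.le_sqrt_of_sq_le (by norm_num)
    linarith
  · rw [div_pow, hσ2, ← hm]
    -- The divisor `9` in `μ = σ / 9` is chosen so that `75 / 9 ^ 2 ≤ 1`.
    have : (T : ℝ) * m * (d / m / T / 9 ^ 2) = d / 81 := by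
      field_simp
      norm_num
    rw [this]
    linarith
  · calc (d : ℝ) ^ (ENNReal.conjExponent s)⁻¹.toReal * (B / Nq) ≤ Nq * (B / Nq) :=
        mul_le_mul_of_nonneg_right hNs hβ
      _ = B := mul_div_cancel₀ _ hNq0.ne'

end CommOpt

theorem theoremt (d r T : ℕ) (hd : 1 ≤ d) (hr : 1 ≤ r) (p : ℝ≥0∞) (hp1 : 1 ≤ p) (hp2 : p < 2)
    (D B : ℝ) (hD : 0 < D) (hB : 0 < B) (hT : (d : ℝ) / (6 * (r : ℝ)) ≤ (T : ℝ)) :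
    (ENNReal.ofReal ((1 / (12 * Real.sqrt 58)) * (D * B / Real.sqrt (T : ℝ)) *
          Real.sqrt ((d : ℝ) / (min d r : ℕ))) ≤
        ⨆ X ∈ CommOpt.domains d p D,
          CommOpt.minmaxError X (CommOpt.convexOracles X p B) T (CommOpt.commChannels d r)) ∧
      (ENNReal.ofReal ((1 / (12 * Real.sqrt 58)) * (D * B / Real.sqrt (T : ℝ)) *
          Real.sqrt ((d : ℝ) / (min d r : ℕ))) ≤
        ⨆ X ∈ CommOpt.domains d p D,
          CommOpt.minmaxError X (CommOpt.convexOracles X 1 B) T (CommOpt.commChannels d r)) := by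
  refine ⟨CommOpt.le_iSup_minmaxError hd hr hp1 le_rfl hD hB hT,
    CommOpt.le_iSup_minmaxError hd hr hp1 ?_ hD hB hT⟩
  -- The conjugate exponent of `1` is `∞`, whose inverse is `0`.
  simp [ENNReal.conjExponent]
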